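/- \textbf{Setting.} A source communicates with a destination through a full-duplex amplify-and-forward (AF) relay that harvests its energy from the source with both of its antennas. Let $0<\alpha<1$ be the fraction of each block used for energy harvesting, $\eta>0$ the energy conversion efficiency, $k=\frac{\eta\alpha}{1-\alpha}$, $P_s>0$ the source power, $N_0>0$ the noise variance, $d_1,d_2>0$ the source--relay and relay--destination distances, $m\in\mathbb R$ the path loss exponent, and $a=\frac{P_s}{N_0d_1^md_2^m}$. The channel power gains $|h_1|^2,|h_2|^2$ (source to the two relay antennas), $|g|^2$ (relay to destination) and $|\hat f|^2$ (residual loopback interference) are mutually independent exponential random variables with means $\lambda_s,\lambda_s,\lambda_d,\lambda_r>0$ respectively. In the loopback-interference dominated scenario the end-to-end SINR is $$\gamma_{\mathsf{AF}}=\frac{\dfrac{P_s|h_1|^2|g|^2}{|\hat f|^2d_1^md_2^m}}{\dfrac{N_0|h_1|^2(1-\alpha)}{\eta\alpha(|h_1|^2+|h_2|^2)|\hat f|^2}+\dfrac{\eta\alpha P_s(|h_1|^2+|h_2|^2)|g|^2}{(1-\alpha)d_1^md_2^m}+N_0},$$ and the ergodic capacity is $R_{\mathsf E}^{\mathsf{AF}}=\mathbb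 E\{\log_2(1+\gamma_{\mathsf{AF}})\}$. \textbf{Statement.} The expectation $R_{\mathsf E}^{\mathsf{AF}}$ is finite, and $R_{\mathsf E}^{\mathsf{AF}}\le R_{\mathsf{up}}^{\mathsf{AF}}$, where $$\begin{aligned}R_{\mathsf{up}}^{\mathsf{AF}}={}&\frac{e^{\frac1{k\lambda_r}}}{\ln 2}\left(E_1\left(\frac1{k\lambda_r}\right)+k\lambda_r\sum_{n=1}^2E_n\left(\frac1{k\lambda_r}\right)\right)\\&-\frac1{\ln 2}\Bigl(1+\psi(1)+\ln(k\lambda_r)+k\lambda_r\bigl(\psi(2)+\ln(k\lambda_r)\bigr)\Bigr)\\&+\frac1{\ln 2}\,G^{1,3}_{3,1}\left(ka\lambda_s\lambda_d\,\Big|\,{-1,1,1\atop 1}\right)\\&-\log_2\left(1+\frac1{k\lambda_r}e^{-1-\psi(1)}+ka\lambda_s\lambda_d\,e^{2\psi(1)}\right).\end{aligned}$$ Here $E_n(x)=\int_1^\infty t^{-n}e^{-xt}\,dt$ is the exponential integral, $\psi=\Gamma'/\Gamma$ is the digamma function, and $G^{m,n}_{p,q}$ is the Meijer G-function, given by its Mellin--Barnes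 integral; in particular, for $z>0$ and any $0<\sigma<1$, $$G^{1,3}_{3,1}\left(z\,\Big|\,{-1,1,1\atop 1}\right)=\frac1{2\pi i}\int_{\sigma-i\infty}^{\sigma+i\infty}\Gamma(1-s)\,\Gamma(2+s)\,\Gamma(s)^2\,z^s\,ds.$$ -/

import Mathlib

open MeasureTheory ProbabilityTheory

namespace FullDuplexAF

/-- The exponential integral `E_n(x) = ∫_1^∞ e^{-x t} / t^n dt` (for real `x > 0`). -/
noncomputable def expIntegral (n : ℕ) (x : ℝ) : ℝ :=
  ∫ t in Set.Ioi (1 : ℝ), Real.exp (-(x * t)) / t ^ n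

/-- The digamma function of a real argument. -/
noncomputable def digamma (x : ℝ) : ℝ := (Complex.digamma (x : ℂ)).re

/-- The Gamma-quotient in the Mellin–Barnes integrand of the Meijer G-function
`G^{m,n}_{p,q}` with upper parameters `a` and lower parameters `b` (indices start at `0`):
`∏_{j<m} Γ(b_j - s) ∏_{j<n} Γ(1 - a_j + s) / (∏_{m≤j<q} Γ(1 - b_j + s) ∏_{n≤j<p} Γ(a_j - s))`. -/
noncomputable def meijerKernel {p q : ℕ} (m n : ℕ) (a : Fin p → ℂ) (b : Fin q → ℂ) (s : ℂ) : ℂ :=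
  ((∏ j : Fin q with j.val < m, Complex.Gamma (b j - s)) *
      ∏ j : Fin p with j.val < n, Complex.Gamma (1 - a j + s)) /
    ((∏ j : Fin q with m ≤ j.val, Complex.Gamma (1 - b j + s)) *
      ∏ j : Fin p with n ≤ j.val, Complex.Gamma (a j - s))

/-- The vertical line `Re s = σ` separates the poles of `Γ(b_j - s)`, `j < m`, (to its right) from
those of `Γ(1 - a_j + s)`, `j < n`, (to its left). -/
def SeparatesPoles {p q : ℕ} (m n : ℕ) (a : Fin p → ℂ) (b : Fin q → ℂ) (σ : ℝ) : Prop :=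
  (∀ j : Fin q, j.val < m → σ < (b j).re) ∧ ∀ j : Fin p, j.val < n → (a j).re - 1 < σ

open Classical in
/-- The Meijer G-function `G^{m,n}_{p,q}(z | a ; b)`, as the Mellin–Barnes integral
`1/(2πi) ∫ meijerKernel(s) z^s ds` along a vertical line that separates the two families of poles
(the contour from `-i∞` to `i∞`); by Cauchy's theorem the line does not matter where the integral
converges absolutely, as it does for `p + q < 2 (m + n)` and `z > 0`. If there is no separating
line, the value is `0` by convention. -/
noncomputable def meijerG {p q : ℕ} (m n : ℕ) (a : Fin p → ℂ) (b : Fin q → ℂ) (z : ℂ) : ℂ :=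
  if h : ∃ σ : ℝ, SeparatesPoles m n a b σ then
    (1 / (2 * Real.pi) : ℂ) *
      ∫ t : ℝ, meijerKernel m n a b (h.choose + t * Complex.I) * z ^ (h.choose + t * Complex.I)
  else 0

/-- `k = η α / (1 - α)`, for energy conversion efficiency `η` and time split `α`. -/
noncomputable def harvestRatio (η α : ℝ) : ℝ := η * α / (1 - α)

/-- End-to-end SINR of loopback-interference dominated full-duplex amplify-and-forward relaying
when both relay antennas harvest energy. The arguments `H₁ H₂ G F` are the channel power gains
`|h₁|², |h₂|², |g|², |f̂|²`, `Ps` the source power, `N₀` the noise variance, `d₁ d₂` the hop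
distances, `m` the path loss exponent. -/
noncomputable def sinrAF (η α Ps N₀ d₁ d₂ m H₁ H₂ G F : ℝ) : ℝ :=
  (Ps * H₁ * G / (F * d₁ ^ m * d₂ ^ m)) /
    (N₀ * H₁ * (1 - α) / (η * α * (H₁ + H₂) * F) +
      η * α * Ps * (H₁ + H₂) * G / ((1 - α) * d₁ ^ m * d₂ ^ m) + N₀)

/-- The closed-form bound, in terms of `k`, `a = Ps / (N₀ d₁^m d₂^m)` and the mean channel power
gains `ls` (source to relay), `ld` (relay to destination), `lr` (residual loopback). -/
noncomputable def capacityBound (k a ls ld lr : ℝ) : ℝ :=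
  Real.exp (1 / (k * lr)) / Real.log 2 *
      (expIntegral 1 (1 / (k * lr)) +
        k * lr * ∑ n ∈ Finset.Icc 1 2, expIntegral n (1 / (k * lr)))
    - 1 / Real.log 2 *
      (1 + digamma 1 + Real.log (k * lr) + k * lr * (digamma 2 + Real.log (k * lr)))
    + (meijerG 1 3 ![-1, 1, 1] ![1] ((k * a * ls * ld : ℝ) : ℂ)).re / Real.log 2
    - Real.logb 2
      (1 + 1 / (k * lr) * Real.exp (-1 - digamma 1) + k * a * ls * ld * Real.exp (2 * digamma 1))

end FullDuplexAF

namespace FullDuplexAF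

open Set Filter Topology

/-! Put `W = H₁ / (k (H₁ + H₂) F)` and `V = k a (H₁ + H₂) G`. Dividing the SINR through by `N₀`
gives `γ = W V / (1 + W + V)`, hence `1 + γ = (1 + W)(1 + V) / (1 + W + V)` (`one_add_sinrAF`) and
`log (1 + γ) = log (1 + W) + log (1 + V) - log (1 + W + V)`. The first two expectations are computed
exactly and the third is bounded below by Jensen's inequality for the convex function `(x, y) ↦ log
(1 + e ^ x + e ^ y)` (`integral_log_le_of_one_add_eq`). By linearity, the dependence between `W` and
`V` is harmless.

After scaling to unit means, `U = H₁ / (H₁ + H₂)` is uniform and `S = H₁ + H₂` has the gamma law of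
shape two (`map_fraction_sum_expMeasure`), so that `W = U / (b F)` and `V = z S G` with `b = k lr`,
`z = k a ls ld`. For `W`, integrating over `U` and then by parts against the exponential law of `F`
gives exponential integrals and digamma values (`integral_log_one_add_div`). For `V`, integration by
parts in `G`, the Mellin–Barnes formula for `x / (1 + x)` and Fubini turn the expectation into a
contour integral of gamma moments, which is the Meijer G-function (`integral_log_eq_meijerG`). The
Jensen point needs only `E log W` and `E log V`, which are digamma values. -/

/-! ### Power and logarithmic moments of gamma laws. -/

theorem gammaMeasure_one_eq_withDensity (a : ℝ) :
    gammaMeasure a 1 = (volume.restrict (Ioi (0 : ℝ))).withDensity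
      fun x => ENNReal.ofReal ((Real.Gamma a)⁻¹ * (x ^ (a - 1) * Real.exp (-x))) := by
  rw [gammaMeasure, ← withDensity_indicator measurableSet_Ioi]
  refine withDensity_congr_ae ?_
  have h0 : ∀ᵐ x : ℝ, x ≠ 0 := by simp [ae_iff]
  filter_upwards [h0] with x hx
  rcases lt_or_gt_of_ne hx with h | h
  · rw [gammaPDF_of_neg h, indicator_of_notMem (by simpa using h.le)]
  · rw [gammaPDF_of_nonneg h.le, indicator_of_mem (by simpa using h)]
    simp [mul_assoc]

theorem integrable_gammaMeasure_iff {E : Type*} [NormedAddCommGroup E] [NormedSpace ℝ E]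
    {a : ℝ} (ha : 0 < a) {f : ℝ → E} :
    Integrable f (gammaMeasure a 1) ↔
      IntegrableOn (fun x => (x ^ (a - 1) * Real.exp (-x)) • f x) (Ioi 0) := by
  have hG := inv_pos.2 (Real.Gamma_pos_of_pos ha)
  rw [gammaMeasure_one_eq_withDensity,
    integrable_withDensity_iff_integrable_smul' (by fun_prop) (by simp), IntegrableOn,
    ← integrable_smul_iff hG.ne' (fun x => (x ^ (a - 1) * Real.exp (-x)) • f x)]
  refine integrable_congr ?_
  filter_upwards [ae_restrict_mem measurableSet_Ioi] with x (hx : 0 < x)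
  rw [ENNReal.toReal_ofReal (by positivity), Pi.smul_apply, smul_smul]

theorem integral_gammaMeasure {E : Type*} [NormedAddCommGroup E] [NormedSpace ℝ E]
    {a : ℝ} (ha : 0 < a) (f : ℝ → E) :
    ∫ x, f x ∂gammaMeasure a 1 =
      (Real.Gamma a)⁻¹ • ∫ x in Ioi 0, (x ^ (a - 1) * Real.exp (-x)) • f x := by
  have hG := inv_pos.2 (Real.Gamma_pos_of_pos ha)
  rw [gammaMeasure_one_eq_withDensity,
    integral_withDensity_eq_integral_toReal_smul (by fun_prop) (by simp), ← integral_smul]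
  refine setIntegral_congr_fun measurableSet_Ioi fun x (hx : 0 < x) => ?_
  rw [ENNReal.toReal_ofReal (by positivity), smul_smul]

theorem ae_pos_gammaMeasure (a : ℝ) : ∀ᵐ x ∂gammaMeasure a 1, 0 < x := by
  rw [gammaMeasure_one_eq_withDensity]
  exact (withDensity_absolutelyContinuous _ _).ae_le (ae_restrict_mem measurableSet_Ioi)

theorem integrable_cpow_gammaMeasure {a : ℝ} (ha : 0 < a) {s : ℂ} (hs : 0 < a + s.re) :
    Integrable (fun x : ℝ => (x : ℂ) ^ s) (gammaMeasure a 1) := by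
  rw [integrable_gammaMeasure_iff ha]
  refine (Complex.GammaIntegral_convergent (s := a + s) (by simpa)).congr_fun
    (fun x (hx : 0 < x) => ?_) measurableSet_Ioi
  simp only [Complex.real_smul, Complex.ofReal_mul, Complex.ofReal_cpow hx.le]
  rw [mul_comm (_ ^ _ : ℂ), mul_assoc, ← Complex.cpow_add _ _ (by exact_mod_cast hx.ne')]
  push_cast
  ring_nf

theorem integral_cpow_gammaMeasure {a : ℝ} (ha : 0 < a) {s : ℂ} (hs : 0 < a + s.re) :
    ∫ x : ℝ, (x : ℂ) ^ s ∂gammaMeasure a 1 = Complex.Gamma (a + s) / Real.Gamma a := by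
  rw [integral_gammaMeasure ha, Complex.Gamma_eq_integral (by simpa), Complex.GammaIntegral,
    Complex.real_smul, div_eq_inv_mul]
  push_cast
  congr 1
  refine setIntegral_congr_fun measurableSet_Ioi fun x (hx : 0 < x) => ?_
  simp only [Complex.real_smul, Complex.ofReal_mul, Complex.ofReal_cpow hx.le]
  rw [mul_comm (_ ^ _ : ℂ), mul_assoc, ← Complex.cpow_add _ _ (by exact_mod_cast hx.ne')]
  push_cast
  ring_nf

theorem integrable_rpow_gammaMeasure {a : ℝ} (ha : 0 < a) {s : ℝ} (hs : 0 < a + s) :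
    Integrable (fun x : ℝ => x ^ s) (gammaMeasure a 1) := by
  refine (integrable_cpow_gammaMeasure ha (s := s) (by simpa)).re.congr ?_
  filter_upwards [ae_pos_gammaMeasure a] with x hx
  rw [← Complex.ofReal_cpow hx.le]
  simp

/-- Differentiating the Mellin transform of `e ^ (-t)` brings down a factor `log t`; convergence is
part of that differentiability theorem. -/
theorem mellinConvergent_log_mul_exp_neg {s : ℂ} (hs : 0 < s.re) :
    MellinConvergent (fun t => Real.log t • ((Real.exp (-t) : ℝ) : ℂ)) s := by
  refine (mellin_hasDerivAt_of_isBigO_rpow (a := s.re + 1) (b := 0) ?_ ?_ (lt_add_one _) ?_ hs).1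
  · have : Continuous fun t : ℝ => ((Real.exp (-t) : ℝ) : ℂ) := by fun_prop
    exact this.continuousOn.locallyIntegrableOn measurableSet_Ioi
  · rw [← Asymptotics.isBigO_norm_left]
    simp_rw [Complex.norm_real, Asymptotics.isBigO_norm_left]
    simpa only [neg_one_mul] using (isLittleO_exp_neg_mul_rpow_atTop zero_lt_one _).isBigO
  · simp_rw [neg_zero, Real.rpow_zero]
    have h : Continuous fun t : ℝ => ((Real.exp (-t) : ℝ) : ℂ) := by fun_prop
    exact ((h.tendsto 0).mono_left nhdsWithin_le_nhds).isBigO_one ℝ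

theorem integrable_log_gammaMeasure {a : ℝ} (ha : 0 < a) :
    Integrable Real.log (gammaMeasure a 1) := by
  rw [integrable_gammaMeasure_iff ha]
  have h : IntegrableOn (fun t : ℝ => RCLike.re
      ((t : ℂ) ^ ((a : ℂ) - 1) • Real.log t • ((Real.exp (-t) : ℝ) : ℂ))) (Ioi 0) :=
    Integrable.re (mellinConvergent_log_mul_exp_neg (s := a) (by simpa))
  refine h.congr_fun (fun x (hx : 0 < x) => ?_) measurableSet_Ioi
  have : ((x : ℂ) ^ ((a : ℂ) - 1)) = ((x ^ (a - 1) : ℝ) : ℂ) := by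
    rw [Complex.ofReal_cpow hx.le]; push_cast; rfl
  simp only [this, smul_eq_mul, Complex.real_smul, ← Complex.ofReal_mul, RCLike.re_to_complex,
    Complex.ofReal_re]
  ring

/-- Differentiation under Euler's integral gives `Γ'(a)`, and the normalisation of the density
divides it by `Γ(a)`. -/
theorem integral_log_gammaMeasure {a : ℝ} (ha : 0 < a) :
    ∫ x, Real.log x ∂gammaMeasure a 1 = digamma a := by
  have hd := Complex.hasDerivAt_GammaIntegral (s := a) (by simpa)
  have hG : Complex.Gamma =ᶠ[𝓝 (a : ℂ)] Complex.GammaIntegral := by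
    have : ∀ᶠ z : ℂ in 𝓝 (a : ℂ), 0 < z.re :=
      Complex.continuous_re.continuousAt.eventually (lt_mem_nhds (by simpa))
    exact this.mono fun z hz => Complex.Gamma_eq_integral hz
  have hd' := (hd.congr_of_eventuallyEq hG).deriv
  have hint : (∫ t : ℝ in Ioi 0, (t : ℂ) ^ ((a : ℂ) - 1) * (Real.log t * Real.exp (-t))) =
      ((∫ x in Ioi 0, (x ^ (a - 1) * Real.exp (-x)) • Real.log x : ℝ) : ℂ) := by
    rw [← integral_complex_ofReal]
    refine setIntegral_congr_fun measurableSet_Ioi fun x (hx : 0 < x) => ?_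
    have : ((x : ℂ) ^ ((a : ℂ) - 1)) = ((x ^ (a - 1) : ℝ) : ℂ) := by
      rw [Complex.ofReal_cpow hx.le]; push_cast; rfl
    simp only [this, smul_eq_mul]
    push_cast
    ring
  rw [integral_gammaMeasure ha, digamma, Complex.digamma_def, logDeriv_apply, hd', hint,
    Complex.Gamma_ofReal, ← Complex.ofReal_div, Complex.ofReal_re, smul_eq_mul, div_eq_inv_mul]

theorem digamma_two : digamma 2 = digamma 1 + 1 := by
  have h := Complex.digamma_apply_add_one 1 fun m h => by
    have := congrArg Complex.re h
    simp at this
    have h0 : (0 : ℝ) ≤ m := m.cast_nonneg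
    linarith
  have h2 : ((2 : ℝ) : ℂ) = 1 + 1 := by norm_num
  rw [digamma, h2, h]
  simp [digamma]

theorem map_mul_gammaMeasure {a r : ℝ} (hr : 0 < r) :
    (gammaMeasure a r).map (r * ·) = gammaMeasure a 1 := by
  ext s hs
  have hm : Measurable fun x : ℝ => r * x := by fun_prop
  have hpdf : Measurable (gammaPDF a 1) := (measurable_gammaPDFReal a 1).ennreal_ofReal
  rw [Measure.map_apply hm hs, gammaMeasure, gammaMeasure, withDensity_apply _ (hm hs),
    withDensity_apply _ hs, ← lintegral_indicator hs, ← lintegral_indicator (hm hs)]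
  conv_rhs => rw [← Real.smul_map_volume_mul_left hr.ne']
  rw [lintegral_smul_measure, lintegral_map (hpdf.indicator hs) hm, smul_eq_mul,
    ← lintegral_const_mul' _ _ (by simp)]
  refine lintegral_congr fun x => ?_
  by_cases hx : r * x ∈ s
  · rw [indicator_of_mem (by exact hx), indicator_of_mem hx, gammaPDF, gammaPDF,
      ← ENNReal.ofReal_mul (abs_nonneg r)]
    congr 1
    unfold gammaPDFReal
    by_cases h0 : 0 ≤ x
    · rw [if_pos h0, if_pos (by positivity), Real.one_rpow, Real.mul_rpow hr.le h0, abs_of_pos hr,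
        Real.rpow_sub_one hr.ne']
      field_simp
    · rw [if_neg h0, if_neg (by rwa [mul_nonneg_iff_of_pos_left hr]), mul_zero]
  · rw [indicator_of_notMem (by exact hx), indicator_of_notMem hx, mul_zero]

/-! ### Mellin–Barnes formula for `x / (1 + x)`. -/

theorem mellinConvergent_inv_one_add {s : ℂ} (h0 : 0 < s.re) (h1 : s.re < 1) :
    MellinConvergent (fun x : ℝ => (((1 + x)⁻¹ : ℝ) : ℂ)) s := by
  refine mellinConvergent_of_isBigO_rpow (a := 1) (b := 0) ?_ ?_ h1 ?_ h0
  · refine (ContinuousOn.locallyIntegrableOn ?_ measurableSet_Ioi)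
    refine Complex.continuous_ofReal.comp_continuousOn (ContinuousOn.inv₀ (by fun_prop) ?_)
    intro x (hx : 0 < x)
    positivity
  · refine Asymptotics.IsBigO.of_bound 1 ?_
    filter_upwards [eventually_gt_atTop 0] with x hx
    rw [Complex.norm_real, Real.norm_of_nonneg (by positivity), Real.rpow_neg_one,
      Real.norm_of_nonneg (by positivity), one_mul]
    exact inv_anti₀ hx (by linarith)
  · refine Asymptotics.IsBigO.of_bound 1 ?_
    filter_upwards [self_mem_nhdsWithin] with x (hx : 0 < x)
    rw [Complex.norm_real, Real.norm_of_nonneg (by positivity), neg_zero, Real.rpow_zero,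
      norm_one, one_mul]
    exact inv_le_one_of_one_le₀ (by linarith)

/-- Write `1 / (1 + v) = ∫ e ^ (-(1 + v) x) dx` and swap: the `v`-integral is `Γ(s) x ^ (-s) e ^
(-x)`, and integrating over `x` yields `Γ(1 - s)`. -/
theorem mellin_inv_one_add {s : ℂ} (h0 : 0 < s.re) (h1 : s.re < 1) :
    mellin (fun x : ℝ => (((1 + x)⁻¹ : ℝ) : ℂ)) s = Complex.Gamma s * Complex.Gamma (1 - s) := by
  have hexp : ∀ v : ℝ, 0 < v → ∫ x in Ioi (0 : ℝ), Real.exp (-((1 + v) * x)) = (1 + v)⁻¹ := by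
    intro v hv
    have h := integral_exp_mul_Ioi (a := -(1 + v)) (by linarith) 0
    rw [mul_zero, Real.exp_zero, neg_div_neg_eq, one_div] at h
    simpa only [neg_mul] using h
  have hexpi : ∀ v : ℝ, 0 < v →
      IntegrableOn (fun x : ℝ => Real.exp (-((1 + v) * x))) (Ioi 0) := by
    intro v hv
    simpa only [neg_mul] using exp_neg_integrableOn_Ioi 0 (b := 1 + v) (by linarith)
  have hpos : ∀ᵐ v ∂volume.restrict (Ioi (0 : ℝ)), 0 < v := ae_restrict_mem measurableSet_Ioi
  have hint : Integrable
      (Function.uncurry fun v x : ℝ => (v : ℂ) ^ (s - 1) * (Real.exp (-((1 + v) * x)) : ℝ))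
      ((volume.restrict (Ioi 0)).prod (volume.restrict (Ioi 0))) := by
    rw [integrable_prod_iff]
    · constructor
      · filter_upwards [hpos] with v hv
        exact (Integrable.ofReal (𝕜 := ℂ) (hexpi v hv)).const_mul ((v : ℂ) ^ (s - 1))
      · refine (mellinConvergent_inv_one_add h0 h1).norm.congr ?_
        filter_upwards [hpos] with v hv
        simp only [Function.uncurry, norm_mul, norm_smul, Complex.norm_real]
        rw [integral_const_mul]
        congr 1
        simp_rw [Real.norm_of_nonneg (Real.exp_nonneg _)]
        rw [hexp v hv, Real.norm_of_nonneg (by positivity)]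
    · refine Measurable.aestronglyMeasurable ?_
      unfold Function.uncurry
      fun_prop
  calc mellin (fun x : ℝ => (((1 + x)⁻¹ : ℝ) : ℂ)) s
      = ∫ v in Ioi (0 : ℝ), ∫ x in Ioi (0 : ℝ),
          (v : ℂ) ^ (s - 1) * (Real.exp (-((1 + v) * x)) : ℝ) := by
        refine setIntegral_congr_fun measurableSet_Ioi fun v (hv : 0 < v) => ?_
        dsimp only
        rw [integral_const_mul, integral_complex_ofReal, hexp v hv, smul_eq_mul]
    _ = ∫ x in Ioi (0 : ℝ), ∫ v in Ioi (0 : ℝ),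
          (v : ℂ) ^ (s - 1) * (Real.exp (-((1 + v) * x)) : ℝ) := integral_integral_swap hint
    _ = ∫ x in Ioi (0 : ℝ), Complex.Gamma s *
          ((Real.exp (-x) : ℝ) * (x : ℂ) ^ ((1 - s) - 1)) := by
        refine setIntegral_congr_fun measurableSet_Ioi fun x (hx : 0 < x) => ?_
        have hx0 : (x : ℂ) ≠ 0 := by exact_mod_cast hx.ne'
        have := Complex.integral_cpow_mul_exp_neg_mul_Ioi h0 hx
        calc ∫ v in Ioi (0 : ℝ), (v : ℂ) ^ (s - 1) * (Real.exp (-((1 + v) * x)) : ℝ)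
            = ∫ v in Ioi (0 : ℝ), (Real.exp (-x) : ℂ) *
                ((v : ℂ) ^ (s - 1) * Complex.exp (-(x * v))) := by
              refine integral_congr_ae (ae_of_all _ fun v => ?_)
              dsimp only
              rw [mul_left_comm, Complex.ofReal_exp, Complex.ofReal_exp, ← Complex.exp_add]
              push_cast
              ring_nf
          _ = _ := by
              rw [integral_const_mul, this, one_div, Complex.inv_cpow _ _ (by
                rw [Complex.arg_ofReal_of_nonneg hx.le]; exact Real.pi_pos.ne),
                ← Complex.cpow_neg]
              ring_nf
    _ = Complex.Gamma s * Complex.Gamma (1 - s) := by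
        rw [integral_const_mul, Complex.Gamma_eq_integral (s := 1 - s) (by simpa),
          Complex.GammaIntegral]

theorem one_add_sq_div_four_le_cosh (x : ℝ) : 1 + x ^ 2 / 4 ≤ Real.cosh x := by
  rw [← Real.cosh_abs, ← sq_abs, Real.cosh_eq]
  have h1 := Real.quadratic_le_exp_of_nonneg (abs_nonneg x)
  have h2 := Real.add_one_le_exp (-|x|)
  linarith

theorem sin_mul_cosh_le_norm_sin {σ : ℝ} (t : ℝ) (h0 : 0 < σ) (h1 : σ < 1) :
    Real.sin (Real.pi * σ) * Real.cosh (Real.pi * t) ≤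
      ‖Complex.sin (Real.pi * (σ + t * Complex.I))‖ := by
  have hs : 0 < Real.sin (Real.pi * σ) :=
    Real.sin_pos_of_pos_of_lt_pi (by positivity) (by nlinarith [Real.pi_pos])
  have h : Complex.sin (Real.pi * (σ + t * Complex.I)) =
      ⟨Real.sin (Real.pi * σ) * Real.cosh (Real.pi * t),
        Real.cos (Real.pi * σ) * Real.sinh (Real.pi * t)⟩ := by
    have : (Real.pi * (σ + t * Complex.I) : ℂ) =
      ((Real.pi * σ : ℝ) : ℂ) + ((Real.pi * t : ℝ) : ℂ) * Complex.I := by push_cast; ring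
    rw [this, Complex.sin_add_mul_I, Complex.mk_eq_add_mul_I]
    push_cast
    rfl
  refine le_trans (le_abs_self _) ?_
  have := Complex.abs_re_le_norm (Complex.sin (Real.pi * (σ + t * Complex.I)))
  rwa [h] at this ⊢

/-- By reflection the product is `π / sin (π s)`, and the sine grows like `cosh (π t)`. Quadratic
decay is all that Mellin inversion and Fubini require. -/
theorem norm_Gamma_mul_Gamma_le {σ : ℝ} (t : ℝ) (h0 : 0 < σ) (h1 : σ < 1) :
    ‖Complex.Gamma (σ + t * Complex.I) * Complex.Gamma (1 - (σ + t * Complex.I))‖ ≤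
      Real.pi / Real.sin (Real.pi * σ) * (1 + t ^ 2)⁻¹ := by
  have hs : 0 < Real.sin (Real.pi * σ) :=
    Real.sin_pos_of_pos_of_lt_pi (by positivity) (by nlinarith [Real.pi_pos])
  rw [Complex.Gamma_mul_Gamma_one_sub, norm_div, Complex.norm_real,
    Real.norm_of_nonneg Real.pi_pos.le, div_mul_eq_mul_div, ← div_eq_mul_inv, div_div]
  refine div_le_div_of_nonneg_left Real.pi_pos.le (by positivity) ?_
  refine le_trans ?_ (sin_mul_cosh_le_norm_sin t h0 h1)
  rw [mul_comm]
  refine mul_le_mul_of_nonneg_left ?_ hs.le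
  refine le_trans ?_ (one_add_sq_div_four_le_cosh _)
  have hpi : 4 ≤ Real.pi ^ 2 := by nlinarith [Real.pi_gt_three]
  nlinarith [mul_nonneg (sq_nonneg t) (sub_nonneg.2 hpi)]

theorem continuous_Gamma_vertical {f : ℝ → ℂ} (hf : Continuous f) (hre : ∀ t, 0 < (f t).re) :
    Continuous fun t => Complex.Gamma (f t) := by
  refine continuous_iff_continuousAt.2 fun t => ContinuousAt.comp ?_ hf.continuousAt
  refine Complex.continuousAt_Gamma _ fun m h => ?_
  have h2 := hre t
  rw [h] at h2
  have h0 : (0 : ℝ) ≤ m := m.cast_nonneg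
  simp at h2
  linarith

theorem integrable_Gamma_mul_Gamma {σ : ℝ} (h0 : 0 < σ) (h1 : σ < 1) :
    Integrable fun t : ℝ =>
      Complex.Gamma (σ + t * Complex.I) * Complex.Gamma (1 - (σ + t * Complex.I)) := by
  refine (integrable_inv_one_add_sq.const_mul (Real.pi / Real.sin (Real.pi * σ))).mono' ?_
    (ae_of_all _ fun t => norm_Gamma_mul_Gamma_le t h0 h1)
  refine (Continuous.mul ?_ ?_).aestronglyMeasurable
  · exact continuous_Gamma_vertical (by fun_prop) fun t => by simpa
  · exact continuous_Gamma_vertical (by fun_prop) fun t => by simpa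

/-- Mellin–Barnes representation of `x / (1 + x)`. -/
theorem div_one_add_eq_integral {σ x : ℝ} (h0 : 0 < σ) (h1 : σ < 1) (hx : 0 < x) :
    ((x / (1 + x) : ℝ) : ℂ) = (1 / (2 * Real.pi) : ℂ) * ∫ t : ℝ,
      Complex.Gamma (σ + t * Complex.I) * Complex.Gamma (1 - (σ + t * Complex.I)) *
        (x : ℂ) ^ (σ + t * Complex.I) := by
  have hm : ∀ t : ℝ, mellin (fun x : ℝ => (((1 + x)⁻¹ : ℝ) : ℂ)) (σ + t * Complex.I) =
      Complex.Gamma (σ + t * Complex.I) * Complex.Gamma (1 - (σ + t * Complex.I)) := fun t =>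
    mellin_inv_one_add (by simpa) (by simpa)
  -- Inversion at `x⁻¹` turns the kernel `x ^ (-s)` into `x ^ s`, as `x / (1 + x) = (1 + x⁻¹)⁻¹`.
  have h := mellinInv_mellin_eq σ (fun x : ℝ => (((1 + x)⁻¹ : ℝ) : ℂ)) (inv_pos.2 hx)
    (mellinConvergent_inv_one_add (by simpa) (by simpa))
    (by simpa only [Complex.VerticalIntegrable, hm] using integrable_Gamma_mul_Gamma h0 h1)
    (by
      refine Complex.continuous_ofReal.continuousAt.comp (ContinuousAt.inv₀ (by fun_prop) ?_)
      positivity)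
  have hx1 : x / (1 + x) = (1 + x⁻¹)⁻¹ := by field_simp; ring
  rw [hx1, ← h, mellinInv]
  simp only [smul_eq_mul, hm, Complex.real_smul]
  congr 1
  · push_cast; rfl
  · refine integral_congr_ae (ae_of_all _ fun t => ?_)
    dsimp only
    rw [Complex.ofReal_inv, Complex.inv_cpow _ _ (by
      rw [Complex.arg_ofReal_of_nonneg hx.le]; exact Real.pi_pos.ne), Complex.cpow_neg, inv_inv,
      mul_comm]

/-! ### Fraction and sum of two exponential variables. -/

theorem expMeasure_eq_withDensity :
    expMeasure 1 = (volume.restrict (Ioi (0 : ℝ))).withDensity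
      fun x => ENNReal.ofReal (Real.exp (-x)) := by
  rw [expMeasure, gammaMeasure_one_eq_withDensity]
  simp

theorem gammaMeasure_two_eq_withDensity :
    gammaMeasure 2 1 = (volume.restrict (Ioi (0 : ℝ))).withDensity
      fun x => ENNReal.ofReal (x * Real.exp (-x)) := by
  rw [gammaMeasure_one_eq_withDensity]
  have : (2 : ℝ) - 1 = 1 := by norm_num
  simp [this]

/-- For independent standard exponential variables `X, Y`, the fraction `X / (X + Y)` is uniform on
`(0, 1)` and independent of the sum `X + Y`, whose law is the gamma law of shape two. -/
theorem map_fraction_sum_expMeasure :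
    ((expMeasure 1).prod (expMeasure 1)).map (fun p : ℝ × ℝ => (p.1 / (p.1 + p.2), p.1 + p.2)) =
      (volume.restrict (Ioo (0 : ℝ) 1)).prod (gammaMeasure 2 1) := by
  have hmap : Measurable fun p : ℝ × ℝ => (p.1 / (p.1 + p.2), p.1 + p.2) := by fun_prop
  have : IsProbabilityMeasure (expMeasure 1) := isProbabilityMeasure_expMeasure one_pos
  have : IsProbabilityMeasure (gammaMeasure 2 1) :=
    isProbabilityMeasure_gammaMeasure two_pos one_pos
  refine Measure.ext_of_lintegral _ fun h hh => ?_
  let D : Set (ℝ × ℝ) := {p | 0 < p.1 ∧ p.1 < p.2}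
  have hD : MeasurableSet D :=
    (measurableSet_lt measurable_const measurable_fst).inter
      (measurableSet_lt measurable_fst measurable_snd)
  -- The integrand in the coordinates `(x, s)` with `s = x + y`: the joint density is `e ^ (-s)` on
  -- `0 < x < s`.
  let F : ℝ × ℝ → ENNReal := D.indicator fun p =>
    ENNReal.ofReal (Real.exp (-p.2)) * h (p.1 / p.2, p.2)
  have hF : Measurable F := Measurable.indicator (by fun_prop) hD
  calc ∫⁻ p, h p ∂((expMeasure 1).prod (expMeasure 1)).map
          (fun p : ℝ × ℝ => (p.1 / (p.1 + p.2), p.1 + p.2))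
      = ∫⁻ x, ∫⁻ y, h (x / (x + y), x + y) ∂expMeasure 1 ∂expMeasure 1 := by
        rw [lintegral_map hh hmap, lintegral_prod _ (by fun_prop)]
    _ = ∫⁻ x, ∫⁻ y, F (x, x + y) := by
        have hy : ∀ x, Measurable fun y => h (x / (x + y), x + y) := fun x => by fun_prop
        have hx : Measurable fun x => ∫⁻ y, h (x / (x + y), x + y) ∂expMeasure 1 :=
          Measurable.lintegral_prod_right' (f := fun p : ℝ × ℝ => h (p.1 / (p.1 + p.2), p.1 + p.2))
            (by fun_prop)
        conv_lhs => rw [expMeasure_eq_withDensity]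
        rw [lintegral_withDensity_eq_lintegral_mul _ (by fun_prop)
          (by rw [← expMeasure_eq_withDensity]; exact hx), ← lintegral_indicator measurableSet_Ioi]
        refine lintegral_congr fun x => ?_
        by_cases h0 : 0 < x
        · rw [indicator_of_mem (by exact h0), Pi.mul_apply,
            lintegral_withDensity_eq_lintegral_mul _ (by fun_prop) (hy x),
            ← lintegral_const_mul' _ _ (by simp), ← lintegral_indicator measurableSet_Ioi]
          refine lintegral_congr fun y => ?_
          by_cases h1 : 0 < y
          · rw [indicator_of_mem (by exact h1)]
            simp only [F]
            rw [indicator_of_mem (show (x, x + y) ∈ D from ⟨h0, by simpa using h1⟩),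
              Pi.mul_apply, ← mul_assoc, ← ENNReal.ofReal_mul (Real.exp_nonneg _), ← Real.exp_add,
              neg_add]
          · rw [indicator_of_notMem (by exact h1)]
            simp only [F]
            rw [indicator_of_notMem fun hm : (x, x + y) ∈ D => h1 (by simpa using hm.2)]
        · rw [indicator_of_notMem (by exact h0)]
          have : ∀ y, F (x, x + y) = 0 := fun y => indicator_of_notMem (fun hm => h0 hm.1) _
          simp [this]
    _ = ∫⁻ x, ∫⁻ s, F (x, s) :=
        lintegral_congr fun x => lintegral_add_left_eq_self (fun s => F (x, s)) x
    _ = ∫⁻ s, ∫⁻ x, F (x, s) := lintegral_lintegral_swap hF.aemeasurable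
    _ = ∫⁻ s, (∫⁻ u in Ioo (0 : ℝ) 1, h (u, s)) ∂gammaMeasure 2 1 := by
        have hs : Measurable fun s => ∫⁻ u in Ioo (0 : ℝ) 1, h (u, s) := hh.lintegral_prod_left'
        rw [gammaMeasure_two_eq_withDensity,
          lintegral_withDensity_eq_lintegral_mul _ (by fun_prop) hs,
          ← lintegral_indicator measurableSet_Ioi]
        refine lintegral_congr fun s => ?_
        by_cases h0 : 0 < s
        · rw [indicator_of_mem (by exact h0), Pi.mul_apply]
          -- The substitution `x = s u` contributes the Jacobian `s`, completing the shape-two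
          -- density `s e ^ (-s)`.
          conv_lhs => rw [← Real.smul_map_volume_mul_left h0.ne']
          rw [lintegral_smul_measure, lintegral_map (by fun_prop) (by fun_prop), smul_eq_mul,
            ENNReal.ofReal_mul h0.le, mul_assoc, abs_of_pos h0,
            ← lintegral_const_mul' (ENNReal.ofReal (Real.exp (-s))) _ (by simp),
            ← lintegral_indicator measurableSet_Ioo]
          congr 1
          refine lintegral_congr fun u => ?_
          simp only [F, D, indicator, mem_ofPred_eq, mem_Ioo, mul_pos_iff_of_pos_left h0,
            mul_lt_iff_lt_one_right h0, mul_div_cancel_left₀ _ h0.ne']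
        · rw [indicator_of_notMem (by exact h0)]
          have : ∀ x, F (x, s) = 0 := fun x => indicator_of_notMem
            (fun hm => h0 (hm.1.trans hm.2)) _
          simp [this]
    _ = _ := (lintegral_prod_symm' _ hh).symm

/-! ### Integration by parts and exponential integrals. -/

instance : IsProbabilityMeasure (gammaMeasure 1 1) :=
  isProbabilityMeasure_gammaMeasure one_pos one_pos

instance : IsProbabilityMeasure (gammaMeasure 2 1) :=
  isProbabilityMeasure_gammaMeasure two_pos one_pos

instance : IsProbabilityMeasure (volume.restrict (Ioo (0 : ℝ) 1)) := ⟨by simp⟩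

theorem integrable_id_gammaMeasure {a : ℝ} (ha : 0 < a) :
    Integrable (fun x : ℝ => x) (gammaMeasure a 1) := by
  simpa using integrable_rpow_gammaMeasure ha (s := 1) (by linarith)

theorem integrable_gammaMeasure_of_quadratic {f : ℝ → ℝ} {C : ℝ} (hf : Measurable f)
    (hC : ∀ x, 0 < x → |f x| ≤ C * (1 + x ^ 2)) : Integrable f (gammaMeasure 1 1) := by
  have h2 : Integrable (fun x : ℝ => x ^ 2) (gammaMeasure 1 1) := by
    simpa using integrable_rpow_gammaMeasure one_pos (s := 2) (by norm_num)
  refine (((integrable_const 1).add h2).const_mul C).mono' hf.aestronglyMeasurable ?_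
  filter_upwards [ae_pos_gammaMeasure 1] with x hx
  exact hC x hx

/-- Integration by parts against the standard exponential law. -/
theorem integral_eq_add_integral_deriv {f f' : ℝ → ℝ} {C C' : ℝ} (hf : Measurable f)
    (hf' : Measurable f') (h0 : ContinuousWithinAt f (Ici 0) 0)
    (hd : ∀ x, 0 < x → HasDerivAt f (f' x) x)
    (hC : ∀ x, 0 < x → |f x| ≤ C * (1 + x ^ 2)) (hC' : ∀ x, 0 < x → |f' x| ≤ C' * (1 + x ^ 2)) :
    ∫ x, f x ∂gammaMeasure 1 1 = f 0 + ∫ x, f' x ∂gammaMeasure 1 1 := by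
  have hi := (integrable_gammaMeasure_iff one_pos).1 (integrable_gammaMeasure_of_quadratic hf hC)
  have hi' := (integrable_gammaMeasure_iff one_pos).1
    (integrable_gammaMeasure_of_quadratic hf' hC')
  rw [integral_gammaMeasure one_pos, integral_gammaMeasure one_pos]
  simp only [Real.Gamma_one, inv_one, sub_self, Real.rpow_zero, one_mul,
    smul_eq_mul] at hi hi' ⊢
  have hlim : Tendsto (fun x => -(Real.exp (-x) * f x)) atTop (𝓝 0) := by
    have hp : Tendsto (fun x : ℝ => C * (Real.exp (-x) + x ^ 2 * Real.exp (-x))) atTop (𝓝 0) := by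
      have h1 := Real.tendsto_pow_mul_exp_neg_atTop_nhds_zero 2
      have h2 := Real.tendsto_exp_neg_atTop_nhds_zero
      simpa using (h2.add h1).const_mul C
    refine squeeze_zero_norm' ?_ hp
    filter_upwards [eventually_gt_atTop 0] with x hx
    rw [norm_neg, norm_mul, Real.norm_of_nonneg (Real.exp_nonneg _), Real.norm_eq_abs]
    have := mul_le_mul_of_nonneg_left (hC x hx) (Real.exp_nonneg (-x))
    linarith
  have h := integral_Ioi_of_hasDerivAt_of_tendsto (f := fun x => -(Real.exp (-x) * f x))
    (f' := fun x => Real.exp (-x) * f x - Real.exp (-x) * f' x) (a := 0)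
    (ContinuousWithinAt.neg (ContinuousWithinAt.mul (by fun_prop) h0))
    (fun x (hx : 0 < x) => by
      have h := (((hasDerivAt_neg x).exp).mul (hd x hx)).neg
      exact h.congr_deriv (by ring)) (hi.sub hi') hlim
  rw [integral_sub hi hi'] at h
  simp at h
  linarith

theorem log_one_add_le {x : ℝ} (hx : 0 ≤ x) : Real.log (1 + x) ≤ x := by
  have := Real.log_le_sub_one_of_pos (show 0 < 1 + x by positivity)
  linarith

/-- Integration by parts, with zero boundary term, trades the logarithm for a rational function; it
serves both the exponential integral and the Mellin–Barnes computation. -/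
theorem integral_log_one_add_mul {w : ℝ} (hw : 0 ≤ w) :
    ∫ x, Real.log (1 + w * x) ∂gammaMeasure 1 1 = ∫ x, w / (1 + w * x) ∂gammaMeasure 1 1 := by
  have h := integral_eq_add_integral_deriv (f := fun x => Real.log (1 + w * x))
    (f' := fun x => w / (1 + w * x)) (C := w) (C' := w) (by fun_prop) (by fun_prop)
    (ContinuousAt.continuousWithinAt (ContinuousAt.log (by fun_prop) (by simp)))
    (fun x hx => by
      have h1 : HasDerivAt (fun x => 1 + w * x) w x := by
        simpa using ((hasDerivAt_id x).const_mul w).const_add 1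
      exact h1.log (by positivity))
    (fun x hx => by
      rw [abs_of_nonneg (Real.log_nonneg (by nlinarith [mul_nonneg hw hx.le]))]
      refine (log_one_add_le (by positivity)).trans (mul_le_mul_of_nonneg_left ?_ hw)
      nlinarith [sq_nonneg (x - 1)])
    (fun x hx => by
      rw [abs_of_nonneg (by positivity)]
      refine (div_le_self hw (by nlinarith [mul_nonneg hw hx.le])).trans ?_
      nlinarith [mul_nonneg hw (sq_nonneg x)])
  simpa using h

theorem expIntegral_integrableOn (n : ℕ) {x : ℝ} (hx : 0 < x) :
    IntegrableOn (fun t : ℝ => Real.exp (-(x * t)) / t ^ n) (Ioi 1) := by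
  have h : IntegrableOn (fun t : ℝ => Real.exp (-(x * t))) (Ioi 1) := by
    simpa only [neg_mul] using exp_neg_integrableOn_Ioi 1 hx
  refine Integrable.mono' h (Measurable.aestronglyMeasurable (by fun_prop)) ?_
  filter_upwards [ae_restrict_mem measurableSet_Ioi] with t (ht : 1 < t)
  rw [Real.norm_of_nonneg (by positivity)]
  exact div_le_self (Real.exp_nonneg _) (one_le_pow₀ ht.le)

/-- Integrate the derivative of `-e ^ (-x t) / t` over `(1, ∞)`. -/
theorem expIntegral_two {x : ℝ} (hx : 0 < x) :
    expIntegral 2 x = Real.exp (-x) - x * expIntegral 1 x := by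
  have h1 := expIntegral_integrableOn 1 hx
  have h2 := expIntegral_integrableOn 2 hx
  have hadd : IntegrableOn (fun t : ℝ => x * (Real.exp (-(x * t)) / t ^ 1) +
      Real.exp (-(x * t)) / t ^ 2) (Ioi 1) := Integrable.add (Integrable.const_mul h1 x) h2
  have hlim : Tendsto (fun t : ℝ => -(Real.exp (-(x * t)) / t)) atTop (𝓝 0) := by
    have h : Tendsto (fun t : ℝ => Real.exp (-(x * t))) atTop (𝓝 0) :=
      Real.tendsto_exp_neg_atTop_nhds_zero.comp (tendsto_id.const_mul_atTop hx)
    simpa using (h.div_atTop tendsto_id).neg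
  have h := integral_Ioi_of_hasDerivAt_of_tendsto (f := fun t : ℝ => -(Real.exp (-(x * t)) / t))
    (f' := fun t => x * (Real.exp (-(x * t)) / t ^ 1) + Real.exp (-(x * t)) / t ^ 2) (a := 1)
    (ContinuousAt.continuousWithinAt
      (ContinuousAt.neg (ContinuousAt.div (by fun_prop) (by fun_prop) one_ne_zero)))
    (fun t (ht : 1 < t) => by
      have ht0 : t ≠ 0 := by positivity
      have h1 : HasDerivAt (fun t => -(x * t)) (-x) t := by
        exact (((hasDerivAt_id' t).const_mul x).neg).congr_deriv (by ring)
      have h := ((h1.exp).div (hasDerivAt_id' t) ht0).neg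
      exact h.congr_deriv (by field_simp; ring)) hadd hlim
  rw [integral_add (Integrable.const_mul h1 x) h2, integral_const_mul] at h
  unfold expIntegral
  simp at h ⊢
  linarith

/-- Substitute `t = 1 + b x`. -/
theorem integral_div_one_add_mul {b : ℝ} (hb : 0 < b) :
    ∫ x, b / (1 + b * x) ∂gammaMeasure 1 1 = Real.exp (1 / b) * expIntegral 1 (1 / b) := by
  have himg : (fun x => 1 + b * x) '' Ioi 0 = Ioi 1 := by
    ext t
    constructor
    · rintro ⟨x, hx : 0 < x, rfl⟩
      simpa using mul_pos hb hx
    · intro (ht : 1 < t)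
      exact ⟨(t - 1) / b, div_pos (by linarith) hb, by field_simp; ring⟩
  rw [integral_gammaMeasure one_pos, expIntegral, ← integral_const_mul, ← himg,
    integral_image_eq_integral_abs_deriv_smul (f' := fun _ => b) measurableSet_Ioi
      (fun x _ => by
        simpa using (((hasDerivAt_id x).const_mul b).const_add 1).hasDerivWithinAt)
      (fun x _ y _ h => by simpa [hb.ne'] using h), ← integral_smul]
  refine setIntegral_congr_fun measurableSet_Ioi fun x _ => ?_
  have hexp : Real.exp (1 / b) * Real.exp (-(1 / b * (1 + b * x))) = Real.exp (-x) := by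
    rw [← Real.exp_add]
    congr 1
    field_simp
    ring
  simp only [Real.Gamma_one, inv_one, sub_self, Real.rpow_zero, smul_eq_mul, abs_of_pos hb, pow_one,
    one_mul, ← hexp]
  ring

theorem abs_mul_log_one_add_le {b x : ℝ} (hb : 0 < b) (hx : 0 < x) :
    |(1 + b * x) * Real.log (1 + b * x)| ≤ (b + b ^ 2) * (1 + x ^ 2) := by
  have hlog : 0 ≤ Real.log (1 + b * x) := Real.log_nonneg (by nlinarith [mul_pos hb hx])
  have hx2 : x ≤ 1 + x ^ 2 := by nlinarith [sq_nonneg (x - 1)]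
  rw [abs_of_nonneg (mul_nonneg (by positivity) hlog)]
  have h1 : (1 + b * x) * Real.log (1 + b * x) ≤ (1 + b * x) * (b * x) :=
    mul_le_mul_of_nonneg_left (log_one_add_le (by positivity)) (by positivity)
  nlinarith [mul_le_mul_of_nonneg_left hx2 hb.le, sq_nonneg b]

theorem integrable_mul_log_one_add {b : ℝ} (hb : 0 < b) :
    Integrable (fun x => (1 + b * x) * Real.log (1 + b * x)) (gammaMeasure 1 1) :=
  integrable_gammaMeasure_of_quadratic (by fun_prop) fun _ hx => abs_mul_log_one_add_le hb hx

/-- The derivative of the integrand is `b log (1 + b x) + b`, so two integrations by parts reach the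
exponential integral. -/
theorem integral_mul_log_one_add {b : ℝ} (hb : 0 < b) :
    ∫ x, (1 + b * x) * Real.log (1 + b * x) ∂gammaMeasure 1 1 =
      b + b * (Real.exp (1 / b) * expIntegral 1 (1 / b)) := by
  have hlog : ∀ x, 0 < x → 0 ≤ Real.log (1 + b * x) := fun x hx =>
    Real.log_nonneg (by nlinarith [mul_pos hb hx])
  have hle : ∀ x, 0 < x → Real.log (1 + b * x) ≤ b * x := fun x hx =>
    log_one_add_le (by positivity)
  have hx2 : ∀ x : ℝ, x ≤ 1 + x ^ 2 := fun x => by nlinarith [sq_nonneg (x - 1)]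
  have hli : Integrable (fun x => Real.log (1 + b * x)) (gammaMeasure 1 1) :=
    integrable_gammaMeasure_of_quadratic (C := b) (by fun_prop) fun x hx => by
      rw [abs_of_nonneg (hlog x hx)]
      nlinarith [hle x hx, hx2 x, mul_le_mul_of_nonneg_left (hx2 x) hb.le]
  have h := integral_eq_add_integral_deriv (f := fun x => (1 + b * x) * Real.log (1 + b * x))
    (f' := fun x => b * Real.log (1 + b * x) + b) (C := b + b ^ 2) (C' := b ^ 2 + b) (by fun_prop)
    (by fun_prop)
    (ContinuousAt.continuousWithinAt
      (ContinuousAt.mul (by fun_prop) (ContinuousAt.log (by fun_prop) (by simp))))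
    (fun x hx => by
      have h1 : HasDerivAt (fun x => 1 + b * x) b x := by
        simpa using ((hasDerivAt_id x).const_mul b).const_add 1
      have h0 : 1 + b * x ≠ 0 := by positivity
      exact (h1.mul (h1.log h0)).congr_deriv (by field_simp))
    (fun x hx => abs_mul_log_one_add_le hb hx)
    (fun x hx => by
      rw [abs_of_nonneg (add_nonneg (mul_nonneg hb.le (hlog x hx)) hb.le)]
      have h1 := mul_le_mul_of_nonneg_left (hle x hx) hb.le
      nlinarith [mul_le_mul_of_nonneg_left (hx2 x) (sq_nonneg b), mul_nonneg hb.le (sq_nonneg x)])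
  rw [h, integral_add (hli.const_mul b) (integrable_const b), integral_const_mul,
    integral_log_one_add_mul hb.le, integral_div_one_add_mul hb]
  simp
  ring

/-! ### Expectation of `log (1 + U / (b F))`. -/

/-- Size-biasing raises the shape from one to two; this is the source of `digamma 2` in the bound.
-/
theorem integral_mul_gammaMeasure (f : ℝ → ℝ) :
    ∫ x, x * f x ∂gammaMeasure 1 1 = ∫ x, f x ∂gammaMeasure 2 1 := by
  rw [integral_gammaMeasure one_pos, integral_gammaMeasure two_pos]
  have h2 : (2 : ℝ) - 1 = 1 := by norm_num
  simp only [Real.Gamma_one, Real.Gamma_two, inv_one, sub_self, Real.rpow_zero, one_mul,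
    h2, Real.rpow_one, smul_eq_mul]
  congr 1
  ext x
  ring

theorem integrable_mul_gammaMeasure {f : ℝ → ℝ} (hf : Integrable f (gammaMeasure 2 1)) :
    Integrable (fun x => x * f x) (gammaMeasure 1 1) := by
  rw [integrable_gammaMeasure_iff two_pos] at hf
  rw [integrable_gammaMeasure_iff one_pos]
  have h2 : (2 : ℝ) - 1 = 1 := by norm_num
  simp only [sub_self, Real.rpow_zero, one_mul, h2, Real.rpow_one, smul_eq_mul] at hf ⊢
  refine hf.congr_fun (fun x _ => ?_) measurableSet_Ioi
  ring

theorem log_mul_ae_eq {b : ℝ} (hb : 0 < b) (a : ℝ) :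
    (fun x => Real.log (b * x)) =ᵐ[gammaMeasure a 1] fun x => Real.log b + Real.log x := by
  filter_upwards [ae_pos_gammaMeasure a] with x hx
  exact Real.log_mul hb.ne' hx.ne'

theorem integrable_log_mul_gammaMeasure {b : ℝ} (hb : 0 < b) :
    Integrable (fun x => Real.log (b * x)) (gammaMeasure 1 1) :=
  ((integrable_const _).add (integrable_log_gammaMeasure one_pos)).congr (log_mul_ae_eq hb 1).symm

theorem integral_log_mul_gammaMeasure {b : ℝ} (hb : 0 < b) :
    ∫ x, Real.log (b * x) ∂gammaMeasure 1 1 = Real.log b + digamma 1 := by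
  rw [integral_congr_ae (log_mul_ae_eq hb 1),
    integral_add (integrable_const _) (integrable_log_gammaMeasure one_pos),
    integral_log_gammaMeasure one_pos]
  simp

theorem integrable_log_mul_gammaMeasure_two {b : ℝ} (hb : 0 < b) :
    Integrable (fun x => Real.log (b * x)) (gammaMeasure 2 1) :=
  ((integrable_const _).add (integrable_log_gammaMeasure two_pos)).congr (log_mul_ae_eq hb 2).symm

theorem integrable_mul_log_mul {b : ℝ} (hb : 0 < b) :
    Integrable (fun x => b * x * Real.log (b * x)) (gammaMeasure 1 1) := by
  simpa only [mul_assoc] using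
    (integrable_mul_gammaMeasure (integrable_log_mul_gammaMeasure_two hb)).const_mul b

theorem integral_mul_log_mul {b : ℝ} (hb : 0 < b) :
    ∫ x, b * x * Real.log (b * x) ∂gammaMeasure 1 1 = b * (digamma 2 + Real.log b) := by
  simp only [mul_assoc]
  rw [integral_const_mul, integral_mul_gammaMeasure (fun x => Real.log (b * x)),
    integral_congr_ae (log_mul_ae_eq hb 2),
    integral_add (integrable_const _) (integrable_log_gammaMeasure two_pos),
    integral_log_gammaMeasure two_pos, integral_const, probReal_univ, one_smul, add_comm]

/-- No sign condition on `y` is needed: `Real.log` is even with `log 0 = 0`, and its primitive `u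
log u - u` works across the origin. -/
theorem integral_log_add_unit {y : ℝ} :
    ∫ u in Ioo (0 : ℝ) 1, Real.log (y + u) =
      (1 + y) * Real.log (1 + y) - y * Real.log y - 1 := by
  rw [← integral_Ioc_eq_integral_Ioo, ← intervalIntegral.integral_of_le zero_le_one,
    intervalIntegral.integral_comp_add_left (fun u => Real.log u), integral_log]
  ring_nf

theorem integrable_log_unit : Integrable Real.log (volume.restrict (Ioo (0 : ℝ) 1)) := by
  have h : IntervalIntegrable Real.log volume 0 1 := intervalIntegral.intervalIntegrable_log'
  exact (h.1).mono_set Ioo_subset_Ioc_self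

theorem integral_log_unit : ∫ u in Ioo (0 : ℝ) 1, Real.log u = -1 := by
  simpa using integral_log_add_unit (y := 0)

theorem ae_unit_prod_gammaMeasure : ∀ᵐ p : ℝ × ℝ
    ∂((volume.restrict (Ioo (0 : ℝ) 1)).prod (gammaMeasure 1 1)),
      (0 < p.1 ∧ p.1 < 1) ∧ 0 < p.2 := by
  filter_upwards [Measure.quasiMeasurePreserving_fst.ae (ae_restrict_mem measurableSet_Ioo),
    Measure.quasiMeasurePreserving_snd.ae (ae_pos_gammaMeasure 1)] with p h1 h2
  exact ⟨h1, h2⟩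

theorem integrable_log_mul_add {b : ℝ} (hb : 0 < b) :
    Integrable (fun p : ℝ × ℝ => Real.log (b * p.2 + p.1))
      ((volume.restrict (Ioo (0 : ℝ) 1)).prod (gammaMeasure 1 1)) := by
  have hdom : Integrable (fun x => |Real.log (b * x)| + (b * x + 1)) (gammaMeasure 1 1) :=
    (integrable_log_mul_gammaMeasure hb).abs.add
      (((integrable_id_gammaMeasure one_pos).const_mul b).add (integrable_const 1))
  refine (hdom.comp_snd (volume.restrict (Ioo (0 : ℝ) 1))).mono'
    (Measurable.aestronglyMeasurable (by fun_prop)) ?_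
  filter_upwards [ae_unit_prod_gammaMeasure] with p ⟨⟨h0, h1⟩, h2⟩
  have hpos : 0 < b * p.2 := by positivity
  have hlow : Real.log (b * p.2) ≤ Real.log (b * p.2 + p.1) :=
    Real.log_le_log hpos (by linarith)
  have hup := Real.log_le_sub_one_of_pos (show 0 < b * p.2 + p.1 by linarith)
  rw [Real.norm_eq_abs, abs_le]
  constructor
  · linarith [neg_abs_le (Real.log (b * p.2))]
  · linarith [abs_nonneg (Real.log (b * p.2))]

theorem log_one_add_div_ae_eq {b : ℝ} (hb : 0 < b) :
    (fun p : ℝ × ℝ => Real.log (1 + p.1 / (b * p.2)))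
      =ᵐ[(volume.restrict (Ioo (0 : ℝ) 1)).prod (gammaMeasure 1 1)]
        fun p => Real.log (b * p.2 + p.1) - Real.log (b * p.2) := by
  filter_upwards [ae_unit_prod_gammaMeasure] with p ⟨⟨h0, _⟩, h2⟩
  have hpos : 0 < b * p.2 := by positivity
  rw [← Real.log_div (by positivity) hpos.ne']
  congr 1
  field_simp

theorem integrable_log_one_add_div {b : ℝ} (hb : 0 < b) :
    Integrable (fun p : ℝ × ℝ => Real.log (1 + p.1 / (b * p.2)))
      ((volume.restrict (Ioo (0 : ℝ) 1)).prod (gammaMeasure 1 1)) :=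
  ((integrable_log_mul_add hb).sub
    ((integrable_log_mul_gammaMeasure hb).comp_snd _)).congr (log_one_add_div_ae_eq hb).symm

theorem integral_log_one_add_div {b : ℝ} (hb : 0 < b) :
    ∫ p : ℝ × ℝ, Real.log (1 + p.1 / (b * p.2))
        ∂((volume.restrict (Ioo (0 : ℝ) 1)).prod (gammaMeasure 1 1)) =
      Real.exp (1 / b) * (expIntegral 1 (1 / b) +
          b * ∑ n ∈ Finset.Icc 1 2, expIntegral n (1 / b)) -
        (1 + digamma 1 + Real.log b + b * (digamma 2 + Real.log b)) := by
  have hsnd : ∫ p : ℝ × ℝ, Real.log (b * p.2)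
      ∂((volume.restrict (Ioo (0 : ℝ) 1)).prod (gammaMeasure 1 1)) = Real.log b + digamma 1 := by
    rw [integral_fun_snd (fun x => Real.log (b * x)), integral_log_mul_gammaMeasure hb]
    simp
  have hint : ∫ x, ((1 + b * x) * Real.log (1 + b * x) - b * x * Real.log (b * x) - 1)
      ∂gammaMeasure 1 1 = b + b * (Real.exp (1 / b) * expIntegral 1 (1 / b)) -
        b * (digamma 2 + Real.log b) - 1 := by
    have hsub : Integrable (fun x => (1 + b * x) * Real.log (1 + b * x) - b * x * Real.log (b * x))
        (gammaMeasure 1 1) := (integrable_mul_log_one_add hb).sub (integrable_mul_log_mul hb)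
    rw [integral_sub hsub (integrable_const 1), integral_sub (integrable_mul_log_one_add hb)
      (integrable_mul_log_mul hb), integral_mul_log_one_add hb, integral_mul_log_mul hb]
    simp
  rw [integral_congr_ae (log_one_add_div_ae_eq hb), integral_sub (integrable_log_mul_add hb)
    ((integrable_log_mul_gammaMeasure hb).comp_snd _), hsnd,
    integral_prod_symm _ (integrable_log_mul_add hb)]
  simp only [integral_log_add_unit]
  have hexp : Real.exp (1 / b) * Real.exp (-(1 / b)) = 1 := by rw [← Real.exp_add]; simp
  -- The recurrence for `E₂` absorbs the free term `b`, giving the form with `E₁ + b (E₁ + E₂)`.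
  have h2 : b * (Real.exp (1 / b) * expIntegral 2 (1 / b)) =
      b - Real.exp (1 / b) * expIntegral 1 (1 / b) := by
    rw [expIntegral_two (by positivity), mul_sub, mul_sub, hexp]
    field_simp
  rw [hint, Finset.sum_Icc_succ_top (by norm_num), Finset.Icc_self, Finset.sum_singleton]
  linarith

/-! ### Expectation of `log (1 + z S G)` as a Meijer G-function. -/

theorem ae_pos_prod_gammaMeasure : ∀ᵐ p : ℝ × ℝ ∂((gammaMeasure 2 1).prod (gammaMeasure 1 1)),
    0 < p.1 ∧ 0 < p.2 := by
  filter_upwards [Measure.quasiMeasurePreserving_fst.ae (ae_pos_gammaMeasure 2),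
    Measure.quasiMeasurePreserving_snd.ae (ae_pos_gammaMeasure 1)] with p h1 h2
  exact ⟨h1, h2⟩

theorem integrable_log_one_add_mul_mul {z : ℝ} (hz : 0 < z) :
    Integrable (fun p : ℝ × ℝ => Real.log (1 + z * p.1 * p.2))
      ((gammaMeasure 2 1).prod (gammaMeasure 1 1)) := by
  have hdom : Integrable (fun p : ℝ × ℝ => z * p.1 * p.2)
      ((gammaMeasure 2 1).prod (gammaMeasure 1 1)) :=
    ((integrable_id_gammaMeasure two_pos).const_mul z).mul_prod (integrable_id_gammaMeasure one_pos)
  refine hdom.mono' (Measurable.aestronglyMeasurable (by fun_prop)) ?_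
  filter_upwards [ae_pos_prod_gammaMeasure] with p ⟨h1, h2⟩
  have hpos : 0 < z * p.1 * p.2 := by positivity
  rw [Real.norm_of_nonneg (Real.log_nonneg (by linarith))]
  exact log_one_add_le hpos.le

theorem measurable_Gamma_mul_Gamma {σ : ℝ} (h0 : 0 < σ) (h1 : σ < 1) :
    Measurable fun t : ℝ =>
      Complex.Gamma (σ + t * Complex.I) * Complex.Gamma (1 - (σ + t * Complex.I)) :=
  (Continuous.mul (continuous_Gamma_vertical (by fun_prop) fun t => by simpa)
    (continuous_Gamma_vertical (by fun_prop) fun t => by simpa)).measurable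

theorem integrable_mellinBarnes {σ z : ℝ} (h0 : 0 < σ) (h1 : σ < 1) (hz : 0 < z) :
    Integrable (fun q : (ℝ × ℝ) × ℝ =>
      ((q.1.1 : ℂ) ^ (σ + q.2 * Complex.I) * (q.1.2 : ℂ) ^ (σ + q.2 * Complex.I - 1)) *
        (Complex.Gamma (σ + q.2 * Complex.I) * Complex.Gamma (1 - (σ + q.2 * Complex.I)) *
          (z : ℂ) ^ (σ + q.2 * Complex.I)))
      (((gammaMeasure 2 1).prod (gammaMeasure 1 1)).prod volume) := by
  have hK := measurable_Gamma_mul_Gamma h0 h1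
  have hdom := (((integrable_rpow_gammaMeasure two_pos (s := σ) (by linarith)).mul_prod
    (integrable_rpow_gammaMeasure one_pos (s := σ - 1) (by linarith)))).mul_prod
      ((integrable_Gamma_mul_Gamma h0 h1).norm.mul_const (z ^ σ))
  refine hdom.mono' (Measurable.aestronglyMeasurable ?_) ?_
  · exact Measurable.mul (by fun_prop) (Measurable.mul (hK.comp measurable_snd) (by fun_prop))
  · filter_upwards [Measure.quasiMeasurePreserving_fst.ae ae_pos_prod_gammaMeasure] with q ⟨h1, h2⟩
    simp only [norm_mul]
    rw [Complex.norm_cpow_eq_rpow_re_of_pos h1, Complex.norm_cpow_eq_rpow_re_of_pos h2,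
      Complex.norm_cpow_eq_rpow_re_of_pos hz]
    simp

/-- By parts in `G`, the integrand becomes `G⁻¹ x / (1 + x)` at `x = z S G`. Mellin–Barnes and
Fubini leave the moments `E S ^ s = Γ(2 + s)` and `E G ^ (s - 1) = Γ(s)`; the other two gamma
factors come from the kernel. -/
theorem integral_log_one_add_mul_mul {σ z : ℝ} (h0 : 0 < σ) (h1 : σ < 1) (hz : 0 < z) :
    ((∫ p : ℝ × ℝ, Real.log (1 + z * p.1 * p.2)
        ∂((gammaMeasure 2 1).prod (gammaMeasure 1 1)) : ℝ) : ℂ) =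
      (1 / (2 * Real.pi) : ℂ) * ∫ t : ℝ,
        Complex.Gamma (1 - (σ + t * Complex.I)) * (Complex.Gamma (2 + (σ + t * Complex.I)) *
          Complex.Gamma (σ + t * Complex.I) * Complex.Gamma (σ + t * Complex.I)) *
            (z : ℂ) ^ (σ + t * Complex.I) := by
  have hI : Integrable (fun p : ℝ × ℝ => z * p.1 / (1 + z * p.1 * p.2))
      ((gammaMeasure 2 1).prod (gammaMeasure 1 1)) := by
    refine (((integrable_id_gammaMeasure two_pos).const_mul z).comp_fst (gammaMeasure 1 1)).mono'
      (Measurable.aestronglyMeasurable (by fun_prop)) ?_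
    filter_upwards [ae_pos_prod_gammaMeasure] with p ⟨h1, h2⟩
    rw [Real.norm_of_nonneg (by positivity)]
    have : 0 < z * p.1 * p.2 := by positivity
    exact div_le_self (by positivity) (by linarith)
  have hparts : ∫ p : ℝ × ℝ, Real.log (1 + z * p.1 * p.2)
        ∂((gammaMeasure 2 1).prod (gammaMeasure 1 1)) =
      ∫ p : ℝ × ℝ, z * p.1 / (1 + z * p.1 * p.2) ∂((gammaMeasure 2 1).prod (gammaMeasure 1 1)) := by
    rw [integral_prod _ (integrable_log_one_add_mul_mul hz), integral_prod _ hI]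
    refine integral_congr_ae ?_
    filter_upwards [ae_pos_gammaMeasure 2] with s hs
    exact integral_log_one_add_mul (by positivity)
  have hpt : ∀ᵐ p : ℝ × ℝ ∂((gammaMeasure 2 1).prod (gammaMeasure 1 1)),
      ((z * p.1 / (1 + z * p.1 * p.2) : ℝ) : ℂ) = (1 / (2 * Real.pi) : ℂ) * ∫ t : ℝ,
        ((p.1 : ℂ) ^ (σ + t * Complex.I) * (p.2 : ℂ) ^ (σ + t * Complex.I - 1)) *
          (Complex.Gamma (σ + t * Complex.I) * Complex.Gamma (1 - (σ + t * Complex.I)) *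
            (z : ℂ) ^ (σ + t * Complex.I)) := by
    filter_upwards [ae_pos_prod_gammaMeasure] with p ⟨hp1, hp2⟩
    have hp2' : (p.2 : ℂ) ≠ 0 := by exact_mod_cast hp2.ne'
    have heq : z * p.1 / (1 + z * p.1 * p.2) =
        z * p.1 * p.2 / (1 + z * p.1 * p.2) * p.2⁻¹ := by field_simp
    rw [heq, Complex.ofReal_mul, div_one_add_eq_integral h0 h1 (by positivity), mul_assoc,
      ← integral_mul_const]
    congr 1
    refine integral_congr_ae (ae_of_all _ fun t => ?_)
    dsimp only
    rw [Complex.ofReal_mul, Complex.ofReal_mul, ← Complex.ofReal_mul,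
      Complex.mul_cpow_ofReal_nonneg (by positivity) hp2.le, Complex.ofReal_mul,
      Complex.mul_cpow_ofReal_nonneg hz.le hp1.le, Complex.cpow_sub _ _ hp2', Complex.cpow_one,
      Complex.ofReal_inv]
    ring
  rw [hparts, ← integral_complex_ofReal, integral_congr_ae hpt, integral_const_mul,
    integral_integral_swap (integrable_mellinBarnes h0 h1 hz)]
  congr 1
  refine integral_congr_ae (ae_of_all _ fun t => ?_)
  dsimp only
  rw [integral_mul_const, integral_prod_mul (fun x : ℝ => (x : ℂ) ^ (σ + t * Complex.I))
    (fun y : ℝ => (y : ℂ) ^ (σ + t * Complex.I - 1)),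
    integral_cpow_gammaMeasure two_pos (by simp; linarith),
    integral_cpow_gammaMeasure one_pos (by simpa)]
  simp only [Real.Gamma_one, Real.Gamma_two, Complex.ofReal_one, div_one, Complex.ofReal_ofNat,
    add_sub_cancel]
  ring

theorem meijerKernel_eq (s : ℂ) : meijerKernel 1 3 ![-1, 1, 1] ![1] s =
    Complex.Gamma (1 - s) *
      (Complex.Gamma (2 + s) * Complex.Gamma s * Complex.Gamma s) := by
  have h2 : (1 : ℂ) + 1 = 2 := by norm_num
  simp [meijerKernel, Finset.prod_filter, Fin.prod_univ_succ, h2, mul_assoc]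

theorem integral_log_eq_meijerG {z : ℝ} (hz : 0 < z) :
    ∫ p : ℝ × ℝ, Real.log (1 + z * p.1 * p.2) ∂((gammaMeasure 2 1).prod (gammaMeasure 1 1)) =
      (meijerG 1 3 ![-1, 1, 1] ![1] (z : ℂ)).re := by
  have h : ∃ σ : ℝ, SeparatesPoles 1 3 ![-1, 1, 1] ![1] σ := by
    refine ⟨1 / 2, fun j _ => ?_, fun j _ => ?_⟩
    · fin_cases j; norm_num
    · fin_cases j <;> norm_num
  -- The chosen abscissa is unspecified, but pole separation forces it into `(0, 1)`, where the
  -- formula holds for every `σ`.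
  have h1 : h.choose < 1 := by simpa using h.choose_spec.1 0 (by simp)
  have h0 : 0 < h.choose := by simpa using h.choose_spec.2 1 (by simp)
  rw [meijerG, dif_pos h]
  simp only [meijerKernel_eq]
  rw [← integral_log_one_add_mul_mul h0 h1 hz, Complex.ofReal_re]

/-! ### Factorisation of the SINR and the Jensen step. -/

theorem one_add_sinrAF {η α Ps N₀ d₁ d₂ m H₁ H₂ G F : ℝ} (hη : 0 < η) (hα₀ : 0 < α) (hα₁ : α < 1)
    (hPs : 0 < Ps) (hN₀ : 0 < N₀) (hd₁ : 0 < d₁) (hd₂ : 0 < d₂) (hH₁ : 0 < H₁) (hH₂ : 0 < H₂)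
    (hG : 0 < G) (hF : 0 < F) {W V : ℝ} (hW : W = H₁ / (harvestRatio η α * (H₁ + H₂) * F))
    (hV : V = harvestRatio η α * (Ps / (N₀ * d₁ ^ m * d₂ ^ m)) * (H₁ + H₂) * G) :
    1 + sinrAF η α Ps N₀ d₁ d₂ m H₁ H₂ G F = (1 + W) * (1 + V) / (1 + W + V) := by
  have h1 : 0 < 1 - α := by linarith
  have e₁ : 0 < d₁ ^ m := Real.rpow_pos_of_pos hd₁ m
  have e₂ : 0 < d₂ ^ m := Real.rpow_pos_of_pos hd₂ m
  have hWpos : 0 < W := by rw [hW, harvestRatio]; positivity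
  have hVpos : 0 < V := by rw [hV, harvestRatio]; positivity
  have hden : N₀ * H₁ * (1 - α) / (η * α * (H₁ + H₂) * F) +
      η * α * Ps * (H₁ + H₂) * G / ((1 - α) * d₁ ^ m * d₂ ^ m) + N₀ = N₀ * (1 + W + V) := by
    rw [hW, hV, harvestRatio]
    field_simp
    ring
  have hnum : Ps * H₁ * G / (F * d₁ ^ m * d₂ ^ m) = N₀ * (W * V) := by
    rw [hW, hV, harvestRatio]
    field_simp
  rw [sinrAF, hden, hnum, mul_div_mul_left _ _ hN₀.ne', eq_div_iff (by positivity), add_mul,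
    div_mul_cancel₀ _ (by positivity)]
  ring

/-- Tangent-plane bound for the convex function `(x, y) ↦ log (1 + e ^ x + e ^ y)`. -/
theorem log_one_add_exp_add_exp_le {W V : ℝ} (hW : 0 < W) (hV : 0 < V) (x y : ℝ) :
    Real.log (1 + Real.exp x + Real.exp y) +
        Real.exp x / (1 + Real.exp x + Real.exp y) * (Real.log W - x) +
        Real.exp y / (1 + Real.exp x + Real.exp y) * (Real.log V - y) ≤
      Real.log (1 + W + V) := by
  set D := 1 + Real.exp x + Real.exp y with hD
  have hDpos : 0 < D := by positivity
  set u := Real.log W - x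
  set v := Real.log V - y
  set A := Real.exp x / D * u + Real.exp y / D * v with hA
  have hWu : W = Real.exp x * Real.exp u := by
    rw [← Real.exp_add, add_sub_cancel, Real.exp_log hW]
  have hVv : V = Real.exp y * Real.exp v := by
    rw [← Real.exp_add, add_sub_cancel, Real.exp_log hV]
  -- Tangent to `exp` at `A`, the mean of `0, u, v` with weights proportional to `1, e ^ x, e ^ y`.
  -- In the weighted sum the linear terms cancel: this is weighted AM–GM.
  have htan : ∀ t, Real.exp A * (1 + t - A) ≤ Real.exp t := fun t => by
    have h := mul_le_mul_of_nonneg_left (Real.add_one_le_exp (t - A)) (Real.exp_nonneg A)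
    rw [← Real.exp_add, add_sub_cancel] at h
    linarith
  have h0 := htan 0
  have hu := mul_le_mul_of_nonneg_left (htan u) (Real.exp_nonneg x)
  have hv := mul_le_mul_of_nonneg_left (htan v) (Real.exp_nonneg y)
  have hDA : D * A = Real.exp x * u + Real.exp y * v := by
    rw [hA]
    field_simp
  have hle : D * Real.exp A ≤ 1 + W + V := by
    rw [Real.exp_zero] at h0
    have : D * Real.exp A = Real.exp A * (1 + 0 - A) + Real.exp x * (Real.exp A * (1 + u - A)) +
        Real.exp y * (Real.exp A * (1 + v - A)) := by
      have : Real.exp A * (D * A) = Real.exp A * (Real.exp x * u + Real.exp y * v) := by rw [hDA]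
      rw [hD] at this ⊢
      linarith
    linarith
  have := Real.log_le_log (by positivity) hle
  rw [Real.log_mul hDpos.ne' (Real.exp_pos A).ne', Real.log_exp] at this
  linarith

/-- Integrates the tangent-plane bound at `(x, y)`. The slopes are nonnegative, so lower bounds for
the two mean logarithms suffice. -/
theorem integral_log_le_of_one_add_eq {Ω : Type*} [MeasurableSpace Ω] {μ : Measure Ω}
    [IsProbabilityMeasure μ] {W V γ : Ω → ℝ} (hγm : AEMeasurable γ μ)
    (hpos : ∀ᵐ ω ∂μ, 0 < W ω ∧ 0 < V ω ∧ 1 + γ ω = (1 + W ω) * (1 + V ω) / (1 + W ω + V ω))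
    (hW1 : Integrable (fun ω => Real.log (1 + W ω)) μ)
    (hV1 : Integrable (fun ω => Real.log (1 + V ω)) μ)
    (hW : Integrable (fun ω => Real.log (W ω)) μ) (hV : Integrable (fun ω => Real.log (V ω)) μ)
    {x y : ℝ} (hx : x ≤ ∫ ω, Real.log (W ω) ∂μ) (hy : y ≤ ∫ ω, Real.log (V ω) ∂μ) :
    Integrable (fun ω => Real.log (1 + γ ω)) μ ∧
      ∫ ω, Real.log (1 + γ ω) ∂μ ≤ ∫ ω, Real.log (1 + W ω) ∂μ + ∫ ω, Real.log (1 + V ω) ∂μ -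
        Real.log (1 + Real.exp x + Real.exp y) := by
  have hlog : ∀ᵐ ω ∂μ, 0 < W ω ∧ 0 < V ω ∧ Real.log (1 + γ ω) =
      Real.log (1 + W ω) + Real.log (1 + V ω) - Real.log (1 + W ω + V ω) := by
    filter_upwards [hpos] with ω ⟨h1, h2, h3⟩
    refine ⟨h1, h2, ?_⟩
    rw [h3, Real.log_div (by positivity) (by positivity), Real.log_mul (by positivity)
      (by positivity)]
  have hint : Integrable (fun ω => Real.log (1 + γ ω)) μ := by
    -- Domination by `log (1 + V)`: `1 ≤ 1 + γ`, while `1 + W ≤ 1 + W + V` gives `γ ≤ V`.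
    refine hV1.mono' (AEMeasurable.aestronglyMeasurable (by fun_prop)) ?_
    filter_upwards [hpos, hlog] with ω ⟨h1, h2, h3⟩ ⟨_, _, h4⟩
    have hge : 1 ≤ 1 + γ ω := by
      rw [h3, one_le_div (by positivity)]
      nlinarith [mul_pos h1 h2]
    rw [Real.norm_of_nonneg (Real.log_nonneg hge), h4]
    have := Real.log_le_log (show 0 < 1 + W ω by positivity)
      (show 1 + W ω ≤ 1 + W ω + V ω by linarith)
    linarith
  refine ⟨hint, ?_⟩
  set p := Real.exp x / (1 + Real.exp x + Real.exp y)
  set q := Real.exp y / (1 + Real.exp x + Real.exp y)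
  set c := Real.log (1 + Real.exp x + Real.exp y)
  have hp : 0 ≤ p := by positivity
  have hq : 0 ≤ q := by positivity
  have hWx : Integrable (fun ω => p * (Real.log (W ω) - x)) μ :=
    (hW.sub (integrable_const x)).const_mul p
  have hVy : Integrable (fun ω => q * (Real.log (V ω) - y)) μ :=
    (hV.sub (integrable_const y)).const_mul q
  have h1 : Integrable (fun ω => Real.log (1 + W ω) + Real.log (1 + V ω)) μ := hW1.add hV1
  have h2 : Integrable (fun ω => Real.log (1 + W ω) + Real.log (1 + V ω) - c) μ :=
    h1.sub (integrable_const c)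
  have h3 : Integrable (fun ω => Real.log (1 + W ω) + Real.log (1 + V ω) - c -
    p * (Real.log (W ω) - x)) μ := h2.sub hWx
  calc ∫ ω, Real.log (1 + γ ω) ∂μ
      ≤ ∫ ω, (Real.log (1 + W ω) + Real.log (1 + V ω) - c - p * (Real.log (W ω) - x) -
          q * (Real.log (V ω) - y)) ∂μ := by
        refine integral_mono_ae hint (h3.sub hVy) ?_
        filter_upwards [hlog] with ω ⟨hw, hv, h4⟩
        rw [h4]
        linarith [log_one_add_exp_add_exp_le hw hv x y]
    _ = ∫ ω, Real.log (1 + W ω) ∂μ + ∫ ω, Real.log (1 + V ω) ∂μ - c -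
          p * (∫ ω, Real.log (W ω) ∂μ - x) - q * (∫ ω, Real.log (V ω) ∂μ - y) := by
        rw [integral_sub h3 hVy, integral_sub h2 hWx, integral_sub h1 (integrable_const c),
          integral_add hW1 hV1, integral_const_mul, integral_const_mul,
          integral_sub hW (integrable_const x), integral_sub hV (integrable_const y)]
        simp
    _ ≤ _ := by
        have := mul_nonneg hp (sub_nonneg.2 hx)
        have := mul_nonneg hq (sub_nonneg.2 hy)
        linarith

/-! ### Transfer of laws to the random variables. -/

section Laws

variable {Ω : Type*} [MeasurableSpace Ω] {μ : Measure Ω}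

theorem hasLaw_div_of_expMeasure {X : Ω → ℝ} {l : ℝ} (hl : 0 < l)
    (hX : HasLaw X (expMeasure (1 / l)) μ) :
    HasLaw (fun ω => X ω / l) (gammaMeasure 1 1) μ := by
  have h : HasLaw (fun x : ℝ => 1 / l * x) (gammaMeasure 1 1) (expMeasure (1 / l)) :=
    ⟨by fun_prop, map_mul_gammaMeasure (by positivity)⟩
  simpa [div_eq_inv_mul] using h.fun_comp hX

theorem hasLaw_prodMk [IsProbabilityMeasure μ] {α β : Type*} [MeasurableSpace α]
    [MeasurableSpace β] {X : Ω → α} {Y : Ω → β} {ν : Measure α} {ρ : Measure β}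
    (hX : HasLaw X ν μ) (hY : HasLaw Y ρ μ) (h : IndepFun X Y μ) :
    HasLaw (fun ω => (X ω, Y ω)) (ν.prod ρ) μ := by
  refine ⟨hX.aemeasurable.prodMk hY.aemeasurable, ?_⟩
  rw [(indepFun_iff_map_prod_eq_prod_map_map hX.aemeasurable hY.aemeasurable).1 h, hX.map_eq,
    hY.map_eq]

/-- Only the marginals are kept: the fraction enters `W` alone and the sum enters `V` alone. -/
theorem hasLaw_fraction_sum [IsProbabilityMeasure μ] {X Y : Ω → ℝ}
    (hX : HasLaw X (gammaMeasure 1 1) μ)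
    (hY : HasLaw Y (gammaMeasure 1 1) μ) (h : IndepFun X Y μ) :
    HasLaw (fun ω => X ω / (X ω + Y ω)) (volume.restrict (Ioo (0 : ℝ) 1)) μ ∧
      HasLaw (fun ω => X ω + Y ω) (gammaMeasure 2 1) μ := by
  have hmap : HasLaw (fun p : ℝ × ℝ => (p.1 / (p.1 + p.2), p.1 + p.2))
      ((volume.restrict (Ioo (0 : ℝ) 1)).prod (gammaMeasure 2 1))
      ((gammaMeasure 1 1).prod (gammaMeasure 1 1)) :=
    ⟨by fun_prop, map_fraction_sum_expMeasure⟩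
  have hjoint := hmap.fun_comp (hasLaw_prodMk hX hY h)
  exact ⟨measurePreserving_fst.fun_comp_hasLaw hjoint,
    measurePreserving_snd.fun_comp_hasLaw hjoint⟩

theorem integrable_of_hasLaw {α : Type*} [MeasurableSpace α] {X : Ω → α} {ν : Measure α}
    (hX : HasLaw X ν μ) {f : α → ℝ} (hf : Integrable f ν) : Integrable (fun ω => f (X ω)) μ := by
  rw [← hX.map_eq] at hf
  exact hf.comp_aemeasurable hX.aemeasurable

theorem integral_of_hasLaw {α : Type*} [MeasurableSpace α] {X : Ω → α} {ν : Measure α}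
    (hX : HasLaw X ν μ) {f : α → ℝ} (hf : Integrable f ν) :
    ∫ ω, f (X ω) ∂μ = ∫ x, f x ∂ν :=
  hX.integral_comp hf.aestronglyMeasurable

end Laws

/-! ### Mean logarithms fixing the Jensen point. -/

theorem integral_log_div {b : ℝ} (hb : 0 < b) :
    Integrable (fun p : ℝ × ℝ => Real.log (p.1 / (b * p.2)))
        ((volume.restrict (Ioo (0 : ℝ) 1)).prod (gammaMeasure 1 1)) ∧
      ∫ p : ℝ × ℝ, Real.log (p.1 / (b * p.2))
        ∂((volume.restrict (Ioo (0 : ℝ) 1)).prod (gammaMeasure 1 1)) =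
      -1 - digamma 1 - Real.log b := by
  have h1 := integrable_log_unit.comp_fst (gammaMeasure 1 1)
  have h2 := (integrable_log_mul_gammaMeasure hb).comp_snd (volume.restrict (Ioo (0 : ℝ) 1))
  have hae : (fun p : ℝ × ℝ => Real.log (p.1 / (b * p.2)))
      =ᵐ[(volume.restrict (Ioo (0 : ℝ) 1)).prod (gammaMeasure 1 1)]
      fun p => Real.log p.1 - Real.log (b * p.2) := by
    filter_upwards [ae_unit_prod_gammaMeasure] with p ⟨⟨h0, _⟩, h2⟩
    rw [Real.log_div h0.ne' (by positivity)]
  refine ⟨(h1.sub h2).congr hae.symm, ?_⟩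
  rw [integral_congr_ae hae, integral_sub h1 h2, integral_fun_fst (fun x => Real.log x),
    integral_fun_snd (fun x => Real.log (b * x)), integral_log_mul_gammaMeasure hb,
    integral_log_unit]
  simp
  ring

theorem integral_log_mul_mul {z : ℝ} (hz : 0 < z) :
    Integrable (fun p : ℝ × ℝ => Real.log (z * p.1 * p.2))
        ((gammaMeasure 2 1).prod (gammaMeasure 1 1)) ∧
      ∫ p : ℝ × ℝ, Real.log (z * p.1 * p.2) ∂((gammaMeasure 2 1).prod (gammaMeasure 1 1)) =
      Real.log z + (1 + 2 * digamma 1) := by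
  have h1 := (integrable_log_gammaMeasure two_pos).comp_fst (gammaMeasure 1 1)
  have h2 := (integrable_log_mul_gammaMeasure hz).comp_snd (gammaMeasure 2 1)
  have hae : (fun p : ℝ × ℝ => Real.log (z * p.1 * p.2))
      =ᵐ[(gammaMeasure 2 1).prod (gammaMeasure 1 1)]
      fun p => Real.log p.1 + Real.log (z * p.2) := by
    filter_upwards [ae_pos_prod_gammaMeasure] with p ⟨h1, h2⟩
    rw [← Real.log_mul h1.ne' (by positivity)]
    ring_nf
  refine ⟨(h1.add h2).congr hae.symm, ?_⟩
  rw [integral_congr_ae hae, integral_add h1 h2, integral_fun_fst (fun x => Real.log x),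
    integral_fun_snd (fun x => Real.log (z * x)), integral_log_mul_gammaMeasure hz,
    integral_log_gammaMeasure two_pos, digamma_two]
  simp
  ring

end FullDuplexAF

/-! ### Assembly of the capacity bound. -/

open FullDuplexAF in
theorem mainTheorem9 {Ω : Type*} [MeasurableSpace Ω] (μ : Measure Ω) [IsProbabilityMeasure μ]
    (η α Ps N₀ d₁ d₂ m ls ld lr : ℝ)
    (hη : 0 < η) (hα₀ : 0 < α) (hα₁ : α < 1) (hPs : 0 < Ps) (hN₀ : 0 < N₀)
    (hd₁ : 0 < d₁) (hd₂ : 0 < d₂) (hls : 0 < ls) (hld : 0 < ld) (hlr : 0 < lr)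
    (h₁ h₂ g f : Ω → ℂ)
    -- exponentially distributed channel power gains with means `ls`, `ls`, `ld`, `lr`
    (law_h₁ : HasLaw (fun ω => ‖h₁ ω‖ ^ 2) (expMeasure (1 / ls)) μ)
    (law_h₂ : HasLaw (fun ω => ‖h₂ ω‖ ^ 2) (expMeasure (1 / ls)) μ)
    (law_g : HasLaw (fun ω => ‖g ω‖ ^ 2) (expMeasure (1 / ld)) μ)
    (law_f : HasLaw (fun ω => ‖f ω‖ ^ 2) (expMeasure (1 / lr)) μ)
    (indep : iIndepFun
      ![fun ω => ‖h₁ ω‖ ^ 2, fun ω => ‖h₂ ω‖ ^ 2, fun ω => ‖g ω‖ ^ 2, fun ω => ‖f ω‖ ^ 2] μ) :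
    Integrable (fun ω => Real.logb 2 (1 + FullDuplexAF.sinrAF η α Ps N₀ d₁ d₂ m
        (‖h₁ ω‖ ^ 2) (‖h₂ ω‖ ^ 2) (‖g ω‖ ^ 2) (‖f ω‖ ^ 2))) μ ∧
      ∫ ω, Real.logb 2 (1 + FullDuplexAF.sinrAF η α Ps N₀ d₁ d₂ m
          (‖h₁ ω‖ ^ 2) (‖h₂ ω‖ ^ 2) (‖g ω‖ ^ 2) (‖f ω‖ ^ 2)) ∂μ ≤
        FullDuplexAF.capacityBound (FullDuplexAF.harvestRatio η α)
          (Ps / (N₀ * d₁ ^ m * d₂ ^ m)) ls ld lr := by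
  set H₁ : Ω → ℝ := fun ω => ‖h₁ ω‖ ^ 2
  set H₂ : Ω → ℝ := fun ω => ‖h₂ ω‖ ^ 2
  set G : Ω → ℝ := fun ω => ‖g ω‖ ^ 2
  set F : Ω → ℝ := fun ω => ‖f ω‖ ^ 2
  have e₁ : 0 < d₁ ^ m := Real.rpow_pos_of_pos hd₁ m
  have e₂ : 0 < d₂ ^ m := Real.rpow_pos_of_pos hd₂ m
  have h1α : 0 < 1 - α := by linarith
  set k := harvestRatio η α with hk
  set a := Ps / (N₀ * d₁ ^ m * d₂ ^ m) with ha
  have hkpos : 0 < k := by rw [hk, harvestRatio]; positivity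
  have hapos : 0 < a := by positivity
  set b := k * lr with hb
  set z := k * a * ls * ld with hz
  have hbpos : 0 < b := by positivity
  have hzpos : 0 < z := by positivity
  have hmeas : ∀ i, AEMeasurable (![H₁, H₂, G, F] i) μ := by
    intro i
    fin_cases i
    exacts [law_h₁.aemeasurable, law_h₂.aemeasurable, law_g.aemeasurable, law_f.aemeasurable]
  have i₁₂ : IndepFun H₁ H₂ μ := indep.indepFun (show (0 : Fin 4) ≠ 1 by decide)
  have iG : IndepFun (fun ω => (H₁ ω, H₂ ω)) G μ :=
    indep.indepFun_prodMk₀ hmeas 0 1 2 (by decide) (by decide)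
  have iF : IndepFun (fun ω => (H₁ ω, H₂ ω)) F μ :=
    indep.indepFun_prodMk₀ hmeas 0 1 3 (by decide) (by decide)
  have l₁ := hasLaw_div_of_expMeasure hls law_h₁
  have l₂ := hasLaw_div_of_expMeasure hls law_h₂
  have lG := hasLaw_div_of_expMeasure hld law_g
  have lF := hasLaw_div_of_expMeasure hlr law_f
  obtain ⟨lU, lS⟩ := hasLaw_fraction_sum l₁ l₂
    (i₁₂.comp (φ := fun x : ℝ => x / ls) (ψ := fun x : ℝ => x / ls) (by fun_prop) (by fun_prop))
  have lUF := hasLaw_prodMk lU lF (iF.comp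
    (φ := fun p : ℝ × ℝ => p.1 / ls / (p.1 / ls + p.2 / ls)) (ψ := fun x : ℝ => x / lr)
    (by fun_prop) (by fun_prop))
  have lSG := hasLaw_prodMk lS lG (iG.comp
    (φ := fun p : ℝ × ℝ => p.1 / ls + p.2 / ls) (ψ := fun x : ℝ => x / ld)
    (by fun_prop) (by fun_prop))
  have pos_of_law : ∀ {X : Ω → ℝ}, HasLaw X (gammaMeasure 1 1) μ → ∀ᵐ ω ∂μ, 0 < X ω := fun hX =>
    ae_of_ae_map hX.aemeasurable (by rw [hX.map_eq]; exact ae_pos_gammaMeasure 1)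
  -- Written in unit-mean variables; the common mean `ls` cancels in the fraction, so `W` depends on
  -- the means only through `b`.
  set W : Ω → ℝ := fun ω => H₁ ω / ls / (H₁ ω / ls + H₂ ω / ls) / (b * (F ω / lr)) with hWdef
  set V : Ω → ℝ := fun ω => z * (H₁ ω / ls + H₂ ω / ls) * (G ω / ld) with hVdef
  have hpos : ∀ᵐ ω ∂μ, 0 < W ω ∧ 0 < V ω ∧
      1 + sinrAF η α Ps N₀ d₁ d₂ m (H₁ ω) (H₂ ω) (G ω) (F ω) =
        (1 + W ω) * (1 + V ω) / (1 + W ω + V ω) := by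
    filter_upwards [pos_of_law l₁, pos_of_law l₂, pos_of_law lG, pos_of_law lF] with ω p₁ p₂ pG pF
    refine ⟨by simp only [hWdef]; positivity, by simp only [hVdef]; positivity, ?_⟩
    rw [div_pos_iff_of_pos_right hls] at p₁ p₂
    rw [div_pos_iff_of_pos_right hld] at pG
    rw [div_pos_iff_of_pos_right hlr] at pF
    refine one_add_sinrAF hη hα₀ hα₁ hPs hN₀ hd₁ hd₂ p₁ p₂ pG pF ?_ ?_
    · simp only [hWdef, hb, ← hk]
      field_simp
    · simp only [hVdef, hz, ← hk, ← ha]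
      field_simp
  obtain ⟨iW, eW⟩ := integral_log_div hbpos
  obtain ⟨iV, eV⟩ := integral_log_mul_mul hzpos
  have iW1 := integrable_log_one_add_div hbpos
  have iV1 := integrable_log_one_add_mul_mul hzpos
  have hEW : ∫ ω, Real.log (W ω) ∂μ = -1 - digamma 1 - Real.log b :=
    (integral_of_hasLaw lUF iW).trans eW
  have hEV : ∫ ω, Real.log (V ω) ∂μ = Real.log z + (1 + 2 * digamma 1) :=
    (integral_of_hasLaw lSG iV).trans eV
  have hEW1 := (integral_of_hasLaw lUF iW1).trans (integral_log_one_add_div hbpos)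
  have hEV1 := (integral_of_hasLaw lSG iV1).trans (integral_log_eq_meijerG hzpos)
  have hγm : AEMeasurable (fun ω => sinrAF η α Ps N₀ d₁ d₂ m (H₁ ω) (H₂ ω) (G ω) (F ω)) μ := by
    have := law_h₁.aemeasurable
    have := law_h₂.aemeasurable
    have := law_g.aemeasurable
    have := law_f.aemeasurable
    unfold sinrAF
    fun_prop
  obtain ⟨hint, hle⟩ := integral_log_le_of_one_add_eq hγm hpos (integrable_of_hasLaw lUF iW1)
    (integrable_of_hasLaw lSG iV1) (integrable_of_hasLaw lUF iW) (integrable_of_hasLaw lSG iV)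
    -- Here `x` is exactly `E log W`, but `y` is `E log V - 1`: the stated bound has `e ^ (2 ψ(1))`
    -- where Jensen would allow `e ^ (1 + 2 ψ(1))`.
    (x := -1 - digamma 1 - Real.log b) (y := Real.log z + 2 * digamma 1) hEW.ge
    (by rw [hEV]; linarith)
  have hlog2 : 0 < Real.log 2 := Real.log_pos one_lt_two
  refine ⟨hint.div_const _, ?_⟩
  have hx : Real.exp (-1 - digamma 1 - Real.log b) = 1 / b * Real.exp (-1 - digamma 1) := by
    rw [Real.exp_sub, Real.exp_log hbpos]
    ring
  have hy : Real.exp (Real.log z + 2 * digamma 1) = z * Real.exp (2 * digamma 1) := by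
    rw [Real.exp_add, Real.exp_log hzpos]
  rw [hx, hy] at hle
  have hle' := div_le_div_of_nonneg_right (hle.trans_eq (by rw [hEW1, hEV1])) hlog2.le
  simp only [Real.logb, integral_div]
  refine hle'.trans_eq ?_
  rw [capacityBound, ← hb, ← hz, Real.logb]
  ring
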